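/- Let $N\cong\mathbb{Z}^2$ be a lattice, $M=\mathrm{Hom}(N,\mathbb{Z})$ its dual lattice and $N_{\mathbb{Q}}=N\otimes_{\mathbb{Z}}\mathbb{Q}$. A nonzero point $x$ of $N$ (or of $M$) is primitive if the segment joining $\mathbf{0}$ and $x$ contains no other lattice points. For an integer $l\ge 1$, a full-dimensional lattice polygon $P\subseteq N_{\mathbb{Q}}$ is called $l$-reflexive if $\mathbf{0}$ lies in the interior of $P$, every vertex of $P$ is primitive, and every edge $F$ of $P$ has local index $l$, that is, $F=\{x\in P\mid\langle u_F,x\rangle=l\}$ for some primitive $u_F\in M$. The order of a lattice polygon $P$ containing $\mathbf{0}$ in its interior is $$o_P:=\min\{k\in\mathbb{Z}_{>0} : \mathrm{int}(P/k)\cap N=\{\mathbf{0}\}\}.$$ If $P$ is an $l$-reflexive polygon, then $o_P$ is well defined and $o_P\le\frac{l+1}{2}$. Moreover, for every odd integer $l\ge 1$ the polygon $P_l:=\mathrm{conv}\{\pm(0,1),\pm(l,2),\pm(l,1)\}$ (with $N=\mathbb{Z}^2$) is an $l$-reflexive hexagon, and $o_{P_l}=\frac{l+1}{2}$. -/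

import Mathlib

open scoped TensorProduct Pointwise

noncomputable section

namespace LReflexive

variable (N : Type*) [AddCommGroup N]

/-- The rational vector space `N_ℚ = ℚ ⊗ N` of a lattice `N`. -/
abbrev RatSpace : Type _ := ℚ ⊗[ℤ] N

variable {N}

/-- The natural map from `N` to `N_ℚ`, sending `x` to `1 ⊗ x`. -/
def toRat (x : N) : RatSpace N := (1 : ℚ) ⊗ₜ[ℤ] x

variable (N) in
/-- The lattice points of `N_ℚ`. -/
def latticePoints : Set (RatSpace N) := Set.range (toRat (N := N))

/-- The pairing of `u` in the dual lattice `M = Hom(N, ℤ)` with a point of `N_ℚ`. -/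
def pairing (u : Module.Dual ℤ N) : RatSpace N →ₗ[ℚ] ℚ := Module.Dual.baseChange ℚ u

/-- A lattice point is primitive if it is nonzero and the segment joining it to the origin
contains no other lattice points. It is used both for `N` and for its dual lattice. -/
def IsPrimitive (x : N) : Prop :=
  x ≠ 0 ∧ ∀ y : N, toRat y ∈ segment ℚ (0 : RatSpace N) (toRat x) → y = 0 ∨ y = x

/-- The topological interior of a subset of `N_ℚ`, for the vector space topology coming from `ℚ`
(the product topology in any coordinates). -/
def interiorQ (P : Set (RatSpace N)) : Set (RatSpace N) :=
  @interior (RatSpace N) (moduleTopology ℚ (RatSpace N)) P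

/-- The vertices of a polytope. -/
def vertices (P : Set (RatSpace N)) : Set (RatSpace N) := P.extremePoints ℚ

/-- A full-dimensional polytope all of whose vertices are lattice points. -/
structure IsLatticePolytope (P : Set (RatSpace N)) : Prop where
  polytope : ∃ S : Finset (RatSpace N), P = convexHull ℚ (S : Set (RatSpace N))
  fullDim : affineSpan ℚ P = ⊤
  vertices_subset : vertices P ⊆ latticePoints N

/-- A facet: a nonempty face of codimension one, a face being the set of points of `P` at which
some linear form attains its maximum over `P`. -/
structure IsFacet (P F : Set (RatSpace N)) : Prop where
  nonempty : F.Nonempty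
  face : ∃ f : RatSpace N →ₗ[ℚ] ℚ, F = {x ∈ P | ∀ y ∈ P, f y ≤ f x}
  codim_one : Module.finrank ℚ (vectorSpan ℚ F) + 1 = Module.finrank ℚ (RatSpace N)

/-- The facet `F` of `P` has local index `k`: for a primitive point `u` of the dual lattice
(the primitive outer normal), `F` is cut out of `P` by `⟨u, x⟩ = k`, where `k > 0`. -/
def HasLocalIndex (P F : Set (RatSpace N)) (k : ℕ) : Prop :=
  0 < k ∧ ∃ u : Module.Dual ℤ N, IsPrimitive u ∧ F = {x ∈ P | pairing u x = (k : ℚ)}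

/-- `P` is an `l`-reflexive polytope. -/
structure IsReflexive (l : ℕ) (P : Set (RatSpace N)) : Prop where
  index_pos : 0 < l
  latticePolytope : IsLatticePolytope P
  zero_mem_interior : (0 : RatSpace N) ∈ interiorQ P
  vertices_primitive : ∀ x : N, toRat x ∈ vertices P → IsPrimitive x
  localIndex : ∀ F : Set (RatSpace N), IsFacet P F → HasLocalIndex P F l

/-- The positive integers `k` such that the origin is the only lattice point in the interior
of `P / k`. -/
def orderSet (P : Set (RatSpace N)) : Set ℕ :=
  {k | 0 < k ∧ interiorQ ((k : ℚ)⁻¹ • P) ∩ latticePoints N = {0}}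

/-- The order `o_P`: the least element of `orderSet P` (and `0` if that set is empty). -/
def order (P : Set (RatSpace N)) : ℕ := sInf (orderSet P)

/-- The hexagon `P_l` with vertices `±(0,1), ±(l,2), ±(l,1)` in the plane of the lattice `ℤ²`. -/
def hexagon (l : ℕ) : Set (RatSpace (Fin 2 → ℤ)) :=
  convexHull ℚ (toRat '' ({![0, 1], ![0, -1], ![(l : ℤ), 2], ![-(l : ℤ), -2],
    ![(l : ℤ), 1], ![-(l : ℤ), -1]} : Set (Fin 2 → ℤ)))

end LReflexive

end

/-! Upper bound. Put `k = ⌊(l+1)/2⌋`, so `l ≤ 2k`. If `x` is a lattice point of `int (P/k)`, every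
edge normal `u` satisfies `k * u x < l`, hence `u x ≤ 1`. It remains to see that only the origin has
height at most one over every edge; `l = 1` is special, since then even `u x < 1`.

Suppose `x ≠ 0` is such a point. An edge normal `u` maximizing `u x` has `u x = 1`, and `l • x` lies
on that edge (`IsReflexive.exists_edge_of_height_le_one`). For `l > 1` it is not a vertex, vertices
being primitive. In lattice coordinates with `x = (0, 1)` and `u` the second coordinate, the edge
lies at height `l` and has ends on both sides of the second axis. The two adjacent edges have
normals `(p, q)` with `l ∣ p` and `q < 0`, by primitivity (`edge_through_top`). Together they force
every vertex below the first axis onto the second axis. Divisibility then shows that the edge after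
the top one ends at `(1, 0)`. The edge after that ends below the first axis, at a primitive point
`(0, Y)` with `l ∣ Y`, which is absurd (`IsReflexive.eq_zero_of_height_le_one`).

Sharpness. In the basis `(0,1)`, `(l,1)` the hexagon is `|α| ≤ 1`, `|β| ≤ 1`, `|α - β| ≤ 1`, and
`(1, 0)` has coordinates `(-1/l, 1/l)`. So `k • (1, 0)` is interior whenever `2k < l`.

Edges are traversed by means of a `Flag`: a supporting form, a direction along its face, and the end
of the face in that direction. -/

namespace LReflexive

/-! ### Lattice points, primitivity and interiors. -/

section Lattice

variable {N : Type*} [AddCommGroup N]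

@[simp]
lemma toRat_add (x y : N) : toRat (x + y) = toRat x + toRat y := TensorProduct.tmul_add _ _ _

@[simp]
lemma toRat_neg (x : N) : toRat (-x) = -toRat x := TensorProduct.tmul_neg _ _

@[simp]
lemma toRat_zero : toRat (0 : N) = 0 := TensorProduct.tmul_zero _ _

lemma toRat_zsmul (c : ℤ) (x : N) : toRat (c • x) = (c : ℚ) • toRat x := by
  rw [toRat, toRat, ← TensorProduct.smul_tmul, TensorProduct.smul_tmul']
  simp

@[simp]
lemma pairing_toRat (u : Module.Dual ℤ N) (x : N) : pairing u (toRat x) = u x := by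
  simp [pairing, toRat]

lemma toRat_injective [Module.Free ℤ N] : Function.Injective (toRat (N := N)) :=
  Module.Flat.tensorProduct_mk_injective (R := ℤ) (S := ℚ) (M := N)

/-- A primitive lattice point is not a proper multiple of a lattice point. -/
lemma IsPrimitive.isUnit_of_zsmul [Module.Free ℤ N] {x y : N} (hx : IsPrimitive x) {d : ℤ}
    (h : x = d • y) : IsUnit d := by
  obtain ⟨h0, hseg⟩ := hx
  have hd : d ≠ 0 := by rintro rfl; simp [h] at h0
  wlog hpos : 0 < d generalizing d y
  · have := @this (-y) (-d) (by simpa using h) (by simpa using hd) (by omega)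
    simpa using this
  have hmem : toRat y ∈ segment ℚ (0 : RatSpace N) (toRat x) := by
    rw [segment_eq_image']
    have hq : (1 : ℚ) ≤ d := by exact_mod_cast hpos
    refine ⟨(d : ℚ)⁻¹, ⟨by positivity, inv_le_one_of_one_le₀ hq⟩, ?_⟩
    simp only [sub_zero, zero_add, h, toRat_zsmul, smul_smul]
    rw [inv_mul_cancel₀ (by positivity), one_smul]
  rcases hseg y hmem with hy | hy
  · simp [h, hy] at h0
  -- Here `y = x`, so `x = d • x`, and `x ≠ 0` gives `d = 1`.
  · have : (d - 1) • x = 0 := by rw [sub_smul, one_smul]; nth_rewrite 1 [← hy]; rw [← h, sub_self]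
    rcases smul_eq_zero.1 this with h1 | h1
    · rw [show d = 1 by omega]; exact isUnit_one
    · exact absurd h1 h0

/-- A lattice point on which some integral form takes the value `1` is primitive. -/
lemma isPrimitive_of_apply_eq_one [Module.Free ℤ N] {x : N} (u : Module.Dual ℤ N) (h : u x = 1) :
    IsPrimitive x := by
  refine ⟨by rintro rfl; simp at h, fun y hy => ?_⟩
  rw [segment_eq_image'] at hy
  obtain ⟨t, ⟨ht0, ht1⟩, hty⟩ := hy
  simp only [sub_zero, zero_add] at hty
  have hu : t = (u y : ℚ) := by
    have := congrArg (pairing u) hty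
    simpa [h] using this
  rw [hu] at ht0 ht1
  have h0 : 0 ≤ u y := by exact_mod_cast ht0
  have h1 : u y ≤ 1 := by exact_mod_cast ht1
  obtain h2 | h2 : u y = 0 ∨ u y = 1 := by omega
  · left; apply toRat_injective; rw [← hty, hu, h2]; simp
  · right; apply toRat_injective; rw [← hty, hu, h2]; simp

variable {P : Set (RatSpace N)}

/-- From a point in the interior one can move a little in every direction. -/
lemma exists_pos_add_smul_mem_of_mem_interiorQ {x : RatSpace N} (hx : x ∈ interiorQ P)
    (d : RatSpace N) : ∃ t : ℚ, 0 < t ∧ x + t • d ∈ P := by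
  let : TopologicalSpace (RatSpace N) := moduleTopology ℚ (RatSpace N)
  have : IsModuleTopology ℚ (RatSpace N) := ⟨rfl⟩
  have := IsModuleTopology.toContinuousSMul ℚ (RatSpace N)
  have := IsModuleTopology.toContinuousAdd ℚ (RatSpace N)
  have hc : Continuous fun t : ℚ => x + t • d := by fun_prop
  have ho : IsOpen ((fun t : ℚ => x + t • d) ⁻¹' interior P) := isOpen_interior.preimage hc
  obtain ⟨ε, hε, hb⟩ := Metric.isOpen_iff.1 ho 0 (by
    rw [Set.mem_preimage, zero_smul, add_zero]
    exact hx)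
  obtain ⟨q, hq0, hq1⟩ := exists_rat_btwn hε
  have hq : (0 : ℚ) < q := by exact_mod_cast hq0
  refine ⟨q, hq, interior_subset (hb (?_ : q ∈ _))⟩
  rw [Metric.mem_ball, Rat.dist_eq]
  simpa [abs_of_pos hq0] using hq1

lemma interiorQ_smul {c : ℚ} (hc : c ≠ 0) : interiorQ (c • P) = c • interiorQ P := by
  let : TopologicalSpace (RatSpace N) := moduleTopology ℚ (RatSpace N)
  have : IsModuleTopology ℚ (RatSpace N) := ⟨rfl⟩
  have := IsModuleTopology.toContinuousSMul ℚ (RatSpace N)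
  exact interior_smul₀ hc P

/-- A linear form bounded on `P` by `c` is less than `c` in the interior. -/
lemma lt_of_mem_interiorQ {x : RatSpace N} (hx : x ∈ interiorQ P) {f : RatSpace N →ₗ[ℚ] ℚ}
    (hf : f ≠ 0) {c : ℚ} (hc : ∀ y ∈ P, f y ≤ c) : f x < c := by
  obtain ⟨d, hd⟩ : ∃ d, 0 < f d := by
    obtain ⟨d, hd⟩ : ∃ d, f d ≠ 0 := by
      by_contra! h
      exact hf (LinearMap.ext h)
    rcases lt_or_gt_of_ne hd with h | h
    · exact ⟨-d, by simpa using h⟩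
    · exact ⟨d, h⟩
  obtain ⟨t, ht, hm⟩ := exists_pos_add_smul_mem_of_mem_interiorQ hx d
  have := hc _ hm
  simp only [map_add, map_smul, smul_eq_mul] at this
  have := mul_pos ht hd
  linarith

end Lattice

/-! ### Faces of finitely generated convex hulls, and rotation of supporting lines. -/

section Polytope

variable {V : Type*} [AddCommGroup V] [Module ℚ V]

lemma le_of_mem_convexHull {S : Set V} {f : V →ₗ[ℚ] ℚ} {c : ℚ} (h : ∀ s ∈ S, f s ≤ c) {y : V}
    (hy : y ∈ convexHull ℚ S) : f y ≤ c :=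
  convexHull_min (t := {y | f y ≤ c}) h (convex_halfSpace_le f.isLinear c) hy

/-- On a face of a convex hull, a linear form is bounded by its values at the generators lying in
that face. -/
lemma le_of_mem_face_convexHull {S : Set V} {f h : V →ₗ[ℚ] ℚ} {l c : ℚ}
    (hf : ∀ s ∈ S, f s ≤ l) (hh : ∀ s ∈ S, f s = l → h s ≤ c) {y : V}
    (hy : y ∈ convexHull ℚ S) (hfy : f y = l) : h y ≤ c := by
  -- This set is a lexicographic half-space for the pair `(f, h)`. It is convex and contains `S`,
  -- hence contains the hull.
  have hconv : Convex ℚ {y : V | f y < l ∨ (f y = l ∧ h y ≤ c)} := by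
    intro y hy z hz a b ha hb hab
    obtain rfl : b = 1 - a := by linarith
    simp only [Set.mem_ofPred_eq, map_add, map_smul, smul_eq_mul] at hy hz ⊢
    have hle : a * f y + (1 - a) * f z ≤ l := by
      have h1 : f y ≤ l := by rcases hy with h | h <;> linarith [h]
      have h2 : f z ≤ l := by rcases hz with h | h <;> linarith [h]
      nlinarith
    rcases hle.lt_or_eq with hlt | heq
    · exact Or.inl hlt
    refine Or.inr ⟨heq, ?_⟩
    rcases ha.eq_or_lt with rfl | ha'
    · have : f z = l := by linarith
      have := hz.resolve_left (by linarith)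
      linarith [this.2]
    rcases hb.eq_or_lt with hb0 | hb'
    · obtain rfl : a = 1 := by linarith
      have := hy.resolve_left (by linarith)
      linarith [this.2]
    rcases hy with hy | hy
    · have h2 : f z ≤ l := by rcases hz with h | h <;> linarith [h]
      nlinarith
    rcases hz with hz | hz
    · nlinarith
    · nlinarith [hy.2, hz.2]
  have := convexHull_min (fun s hs => (hf s hs).lt_or_eq.imp id fun h => ⟨h, hh s hs h⟩) hconv hy
  exact (this.resolve_left (by linarith)).2

/-- A point at which a linear form, and after it a second one, is maximal, is extreme if the two
forms are jointly injective. -/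
lemma mem_extremePoints_of_lex {P : Set V} {f h : V →ₗ[ℚ] ℚ} {w : V} (hw : w ∈ P)
    (hf : ∀ y ∈ P, f y ≤ f w) (hh : ∀ y ∈ P, f y = f w → h y ≤ h w)
    (hinj : ∀ y, f y = 0 → h y = 0 → y = 0) : w ∈ P.extremePoints ℚ := by
  refine ⟨hw, ?_⟩
  rintro y hy z hz ⟨a, b, ha, hb, hab, rfl⟩
  obtain rfl : b = 1 - a := by linarith
  simp only [map_add, map_smul, smul_eq_mul] at hf hh
  have hfy := hf y hy
  have hfz := hf z hz
  have e1 : f y = f z := by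
    apply le_antisymm <;> nlinarith
  have hhy := hh y hy (by rw [e1]; ring)
  have hhz := hh z hz (by rw [e1]; ring)
  have e2 : h y = h z := by
    apply le_antisymm <;> nlinarith
  have : y - z = 0 := hinj _ (by simp [e1]) (by simp [e2])
  rw [sub_eq_zero] at this
  subst this
  rw [← add_smul, hab, one_smul]

/-- The point `w` of `P` lies on the face `f = l` of `P`, and on that face `h` is at most
`h w = 0`, for two forms `f`, `h` which together separate points. -/
structure Flag (P : Set V) (l : ℚ) (f h : V →ₗ[ℚ] ℚ) (w : V) : Prop where
  le : ∀ y ∈ P, f y ≤ l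
  mem : w ∈ P
  apply_eq : f w = l
  apply_eq_zero : h w = 0
  nonpos : ∀ y ∈ P, f y = l → h y ≤ 0
  inj : ∀ y, f y = 0 → h y = 0 → y = 0
  ne_zero : h ≠ 0

lemma Flag.mem_extremePoints {P : Set V} {l : ℚ} {f h : V →ₗ[ℚ] ℚ} {w : V} (H : Flag P l f h w) :
    w ∈ P.extremePoints ℚ :=
  mem_extremePoints_of_lex H.mem (fun y hy => H.apply_eq ▸ H.le y hy)
    (fun y hy h => H.apply_eq_zero ▸ H.nonpos y hy (h.trans H.apply_eq)) H.inj

/-- On every face of a polytope, a second linear form attains its maximum. -/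
lemma exists_flag {S : Finset V} {l : ℚ} (hl : l ≠ 0) {f h : V →ₗ[ℚ] ℚ}
    (hf : ∀ s ∈ S, f s ≤ l) (hex : ∃ s ∈ S, f s = l) (hinj : ∀ y, f y = 0 → h y = 0 → y = 0)
    (hne : ∃ y, f y = 0 ∧ h y ≠ 0) :
    ∃ w ∈ S, Flag (convexHull ℚ (S : Set V)) l f (h - (h w / l) • f) w ∧
      ∀ y ∈ convexHull ℚ (S : Set V), f y = l → h y ≤ h w := by
  classical
  obtain ⟨s, hs, hsl⟩ := hex
  obtain ⟨w, hw, hmax⟩ := (S.filter fun s => f s = l).exists_max_image h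
    ⟨s, by simp [hs, hsl]⟩
  simp only [Finset.mem_filter, and_imp] at hw hmax
  have hle : ∀ y ∈ convexHull ℚ (S : Set V), f y = l → h y ≤ h w := fun y hy hyl =>
    le_of_mem_face_convexHull (fun s hs => hf s hs) (fun s hs => hmax s hs) hy hyl
  refine ⟨w, hw.1, ⟨fun y hy => le_of_mem_convexHull (fun s hs => hf s hs) hy,
    subset_convexHull ℚ _ hw.1, hw.2, ?_, fun y hy hyl => ?_, fun y h1 h2 => ?_, fun h0 => ?_⟩, hle⟩
  · simp [hw.2, hl]
  · simpa [hyl, hl] using hle y hy hyl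
  · exact hinj y h1 (by simpa [h1] using h2)
  · obtain ⟨y, hy1, hy2⟩ := hne
    have := LinearMap.congr_fun h0 y
    simp [hy1, hy2] at this

/-- Rotating a supporting line about a point of the polytope until it meets a further
generator. -/
lemma Flag.exists_rotate {S : Finset V} {l : ℚ} (hl : l ≠ 0)
    (hS : ∀ g : V →ₗ[ℚ] ℚ, g ≠ 0 → ∃ s ∈ S, 0 < g s) {f h : V →ₗ[ℚ] ℚ} {w : V}
    (H : Flag (convexHull ℚ (S : Set V)) l f h w) :
    ∃ t : ℚ, 0 < t ∧ ∃ s ∈ S, 0 < h s ∧ Flag (convexHull ℚ (S : Set V)) l (f + t • h)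
      (h - (h s / l) • (f + t • h)) s := by
  classical
  obtain ⟨s₁, hs₁, hp₁⟩ := hS h H.ne_zero
  obtain ⟨s₀, hs₀, hmin⟩ := (S.filter fun s => 0 < h s).exists_min_image
    (fun s => (l - f s) / h s) ⟨s₁, by simp [hs₁, hp₁]⟩
  simp only [Finset.mem_filter, and_imp] at hs₀ hmin
  obtain ⟨hs₀, hp⟩ := hs₀
  -- The smallest `t` at which `f + t • h` reaches `l` at a generator with `h > 0`. Generators with
  -- `h ≤ 0` stay below `l` because `t > 0`, and `w` stays on the line because `h w = 0`.
  set t := (l - f s₀) / h s₀ with ht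
  have hsub : ∀ s ∈ S, s ∈ convexHull ℚ (S : Set V) := fun s hs => subset_convexHull ℚ _ hs
  have hlt : f s₀ < l := by
    refine lt_of_le_of_ne (H.le _ (hsub _ hs₀)) fun h => ?_
    exact absurd (H.nonpos _ (hsub _ hs₀) h) (not_le.2 hp)
  have htpos : 0 < t := div_pos (by linarith) hp
  have hS₀ : (f + t • h) s₀ = l := by
    simp only [LinearMap.add_apply, LinearMap.smul_apply, smul_eq_mul, ht]
    rw [div_mul_cancel₀ _ hp.ne']
    ring
  obtain ⟨s, hs, hflag, hmax⟩ := exists_flag (S := S) hl (f := f + t • h) (h := h) (fun s hs => by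
      simp only [LinearMap.add_apply, LinearMap.smul_apply, smul_eq_mul]
      rcases lt_or_ge 0 (h s) with hpos | hneg
      · have := hmin s hs hpos
        rw [le_div_iff₀ hpos] at this
        linarith
      · have := H.le s (hsub s hs)
        nlinarith) ⟨s₀, hs₀, hS₀⟩
    (fun y h1 h2 => H.inj y (by simpa [h2] using h1) h2) ⟨s₀ - w, by rw [map_sub, hS₀]; simp [H.apply_eq, H.apply_eq_zero],
      by simpa [H.apply_eq_zero] using hp.ne'⟩
  exact ⟨t, htpos, s, hs, hp.trans_le (hmax _ (hsub _ hs₀) hS₀), hflag⟩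

end Polytope

/-! ### Edges of a reflexive polygon and passage between them. -/

section Polygon

variable {N : Type*} [AddCommGroup N]

/-- A face of a polygon containing two different points, at which a form takes a nonzero maximum,
is a facet. -/
lemma isFacet_of_flag [Module.Free ℤ N] [Module.Finite ℤ N] (hN : Module.finrank ℤ N = 2)
    {P : Set (RatSpace N)} {l : ℚ} (hl : l ≠ 0) {f h : RatSpace N →ₗ[ℚ] ℚ} {w z : RatSpace N}
    (H : Flag P l f h w) (hz : z ∈ P) (hfz : f z = l) (hhz : h z < 0) :
    IsFacet P {x ∈ P | f x = l} := by
  have hface : {x ∈ P | f x = l} = {x ∈ P | ∀ y ∈ P, f y ≤ f x} := by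
    ext x
    refine and_congr_right fun hx => ⟨fun h y hy => h ▸ H.le y hy, fun h => ?_⟩
    exact le_antisymm (H.le x hx) (H.apply_eq ▸ h w H.mem)
  have hdim : Module.finrank ℚ (RatSpace N) = 2 := by rw [Module.finrank_baseChange, hN]
  refine ⟨⟨w, H.mem, H.apply_eq⟩, ⟨f, hface⟩, ?_⟩
  have hrk := LinearMap.finrank_range_add_finrank_ker f
  have hsurj : LinearMap.range f = ⊤ := LinearMap.range_eq_top.2 <|
    LinearMap.surjective fun h0 => hl (by rw [← H.apply_eq, h0, LinearMap.zero_apply])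
  rw [hsurj, finrank_top, Module.finrank_self, hdim] at hrk
  -- The direction of the face lies in the line `ker f`, and it is nonzero because `h` separates `z`
  -- from `w`; so its rank is exactly one.
  have hsub : vectorSpan ℚ {x ∈ P | f x = l} ≤ LinearMap.ker f := by
    rw [vectorSpan_def, Submodule.span_le]
    rintro _ ⟨x, hx, y, hy, rfl⟩
    simp [hx.2, hy.2]
  have hle := Submodule.finrank_mono hsub
  have hpos : 0 < Module.finrank ℚ (vectorSpan ℚ {x ∈ P | f x = l}) := by
    rw [Module.finrank_pos_iff, Submodule.nontrivial_iff_ne_bot]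
    intro hbot
    have hm : z - w ∈ vectorSpan ℚ {x ∈ P | f x = l} :=
      vsub_mem_vectorSpan ℚ ⟨hz, hfz⟩ ⟨H.mem, H.apply_eq⟩
    rw [hbot, Submodule.mem_bot, sub_eq_zero] at hm
    rw [hm, H.apply_eq_zero] at hhz
    exact lt_irrefl _ hhz
  omega

/-- A form of height `l` supporting an `l`-reflexive polygon along an edge is the pairing with a
primitive point of the dual lattice. -/
lemma IsReflexive.exists_pairing_eq [Module.Free ℤ N] [Module.Finite ℤ N]
    (hN : Module.finrank ℤ N = 2) {l : ℕ} {P : Set (RatSpace N)} (hP : IsReflexive l P)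
    {f h : RatSpace N →ₗ[ℚ] ℚ} {w z : RatSpace N} (H : Flag P l f h w) (hz : z ∈ P)
    (hfz : f z = l) (hhz : h z < 0) : ∃ u : Module.Dual ℤ N, IsPrimitive u ∧ pairing u = f := by
  have hl : (l : ℚ) ≠ 0 := by exact_mod_cast hP.index_pos.ne'
  obtain ⟨-, u, hu, hF⟩ := hP.localIndex _ (isFacet_of_flag hN hl H hz hfz hhz)
  have huw : pairing u w = l := (hF.subset ⟨H.mem, H.apply_eq⟩).2
  have huz : pairing u z = l := (hF.subset ⟨hz, hfz⟩).2
  refine ⟨u, hu, LinearMap.ext fun y => ?_⟩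
  -- `w` and `z` form a basis of the plane; these are the coordinates of `y`, solved from its values
  -- under `f` and `h`. Both `pairing u` and `f` equal `l` on this basis.
  have hy : y - ((f y / l - h y / h z) • w + (h y / h z) • z) = 0 := by
    apply H.inj
    · simp only [map_sub, map_add, map_smul, smul_eq_mul, H.apply_eq, hfz]
      field_simp
      ring
    · simp only [map_sub, map_add, map_smul, smul_eq_mul, H.apply_eq_zero]
      field_simp [hhz.ne]
      ring
  rw [sub_eq_zero] at hy
  conv_lhs => rw [hy]
  simp only [map_add, map_smul, smul_eq_mul, huw, huz]
  field_simp
  ring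

/-- A nonzero form that is nonpositive on the generators would be negative at the interior point
`0`. -/
lemma IsReflexive.exists_pos {l : ℕ} {P : Set (RatSpace N)} (hP : IsReflexive l P)
    {S : Finset (RatSpace N)} (hS : P = convexHull ℚ (S : Set _))
    (g : RatSpace N →ₗ[ℚ] ℚ) (hg : g ≠ 0) : ∃ s ∈ S, 0 < g s := by
  by_contra! hn
  have := lt_of_mem_interiorQ hP.zero_mem_interior hg (c := 0)
    fun y hy => le_of_mem_convexHull hn (hS ▸ hy)
  simp at this

variable (P : Set (RatSpace N)) (l : ℕ) in
/-- A flag of `P` whose first form is the pairing with a primitive point `u` of the dual lattice,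
and whose second form is not constant on the edge of `P` cut out by `u`. -/
structure EdgeFlag (u : Module.Dual ℤ N) (h : RatSpace N →ₗ[ℚ] ℚ) (n : N) : Prop where
  flag : Flag P l (pairing u) h (toRat n)
  primitive : IsPrimitive u
  primitive_vertex : IsPrimitive n
  exists_neg : ∃ z ∈ P, pairing u z = l ∧ h z < 0

section

variable [Module.Free ℤ N] [Module.Finite ℤ N] (hN : Module.finrank ℤ N = 2) {l : ℕ}
  {P : Set (RatSpace N)} (hP : IsReflexive l P)
include hN hP

/-- The point `w` is lexicographically maximal for `(f, h)`, hence a vertex; so it is a primitive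
lattice point. The point `z` guarantees that the face is a true edge. -/
lemma IsReflexive.exists_edgeFlag {f h : RatSpace N →ₗ[ℚ] ℚ} {w z : RatSpace N}
    (H : Flag P l f h w) (hz : z ∈ P) (hfz : f z = l) (hhz : h z < 0) :
    ∃ (u : Module.Dual ℤ N) (n : N), EdgeFlag P l u h n ∧ pairing u = f ∧ toRat n = w := by
  obtain ⟨u, hu, rfl⟩ := hP.exists_pairing_eq hN H hz hfz hhz
  obtain ⟨n, rfl⟩ := hP.latticePolytope.vertices_subset H.mem_extremePoints
  exact ⟨u, n, ⟨H, hu, hP.vertices_primitive n H.mem_extremePoints, z, hz, hfz, hhz⟩, rfl, rfl⟩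

/-- Passing from an edge to the next one at a vertex. -/
lemma IsReflexive.exists_rotate {f h : RatSpace N →ₗ[ℚ] ℚ} {w : RatSpace N}
    (H : Flag P l f h w) :
    ∃ (t : ℚ) (u : Module.Dual ℤ N) (n : N), 0 < t ∧ 0 < h (toRat n) ∧ pairing u = f + t • h ∧
      EdgeFlag P l u (h - (h (toRat n) / l) • pairing u) n := by
  have hl : (l : ℚ) ≠ 0 := by exact_mod_cast hP.index_pos.ne'
  obtain ⟨S, hS⟩ := hP.latticePolytope.polytope
  obtain ⟨t, ht, s, -, hs, hF⟩ := Flag.exists_rotate hl (hP.exists_pos hS) (hS ▸ H)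
  rw [← hS] at hF
  obtain ⟨u, n, hE, hu, rfl⟩ := hP.exists_edgeFlag hN hF H.mem
    (by simp [H.apply_eq, H.apply_eq_zero])
    (by simpa [H.apply_eq, H.apply_eq_zero, hl] using hs)
  exact ⟨t, u, n, ht, hs, hu, hu.symm ▸ hE⟩

/-- The other end of an edge. -/
lemma IsReflexive.exists_opposite {u : Module.Dual ℤ N} {h : RatSpace N →ₗ[ℚ] ℚ} {n : N}
    (H : EdgeFlag P l u h n) :
    ∃ m : N, h (toRat m) < 0 ∧ EdgeFlag P l u (-h + (h (toRat m) / l) • pairing u) m := by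
  have hl : (l : ℚ) ≠ 0 := by exact_mod_cast hP.index_pos.ne'
  obtain ⟨S, hS⟩ := hP.latticePolytope.polytope
  obtain ⟨z, hz, huz, hhz⟩ := H.exists_neg
  have hF := H.flag
  have hle := hF.le
  have hS' : ∀ s ∈ S, s ∈ P := fun s hs => hS ▸ subset_convexHull ℚ _ hs
  -- The maximum of `pairing u` over `S` bounds it on all of `P`, and the value `l` is taken at `z`.
  have hex : ∃ s ∈ S, pairing u s = l := by
    by_contra! hn
    obtain ⟨s, hs, hmax⟩ := S.exists_max_image (pairing u) (by
      obtain ⟨s, hs, -⟩ := hP.exists_pos hS h hF.ne_zero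
      exact ⟨s, hs⟩)
    have h1 := le_of_mem_convexHull hmax (hS ▸ hz)
    exact hn s hs (le_antisymm (hle s (hS' s hs)) (huz ▸ h1))
  obtain ⟨w, -, hw, hmax⟩ := exists_flag (S := S) hl (f := pairing u) (h := -h)
    (fun s hs => hle s (hS' s hs)) hex (fun y h1 h2 => hF.inj y h1 (by simpa using h2))
    ⟨z - toRat n, by rw [map_sub, huz, hF.apply_eq, sub_self],
      by simpa [hF.apply_eq_zero] using hhz.ne⟩
  rw [← hS] at hw hmax
  have hwz := hmax z hz huz
  have e : -h - ((-h) w / l) • pairing u = -h + (h w / l) • pairing u := by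
    rw [LinearMap.neg_apply, neg_div, neg_smul, sub_neg_eq_add]
  rw [e] at hw
  simp only [LinearMap.neg_apply, neg_le_neg_iff] at hwz
  have hneg : h w < 0 := hwz.trans_lt hhz
  obtain ⟨u', m, hE, hu, rfl⟩ := hP.exists_edgeFlag hN hw hF.mem hF.apply_eq
    (by simpa [hF.apply_eq, hF.apply_eq_zero, hl] using hneg)
  have huu : u' = u := by
    ext x
    have := LinearMap.congr_fun hu (toRat x)
    simpa using this
  exact ⟨m, hneg, huu ▸ hE⟩

end

end Polygon

/-! ### Adapted lattice bases, and the edge below which a point of height one lies. -/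

section Rank2

variable {N : Type*} [AddCommGroup N]

lemma basis_repr_two (b : Module.Basis (Fin 2) ℤ N) (n : N) :
    n = b.coord 0 n • b 0 + b.coord 1 n • b 1 := by
  conv_lhs => rw [← b.sum_repr n, Fin.sum_univ_two]
  rfl

lemma ratSpace_eq_of_basis (b : Module.Basis (Fin 2) ℤ N) (y : RatSpace N) :
    y = pairing (b.coord 0) y • toRat (b 0) + pairing (b.coord 1) y • toRat (b 1) := by
  induction y using TensorProduct.induction_on with
  | zero => simp
  | tmul c n =>
    have h : c ⊗ₜ[ℤ] n = c • toRat n := by simp [toRat, TensorProduct.smul_tmul']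
    rw [h]
    simp only [map_smul, pairing_toRat, smul_eq_mul, mul_smul, ← smul_add]
    congr 1
    rw [← toRat_zsmul, ← toRat_zsmul, ← toRat_add, ← basis_repr_two b n]
  | add y z hy hz =>
    conv_lhs => rw [hy, hz]
    simp only [map_add, add_smul]
    abel

/-- A lattice point of height one and a generator of the kernel form a basis of the lattice. -/
lemma exists_complement [Module.Free ℤ N] [Module.Finite ℤ N] (hN : Module.finrank ℤ N = 2)
    {u : Module.Dual ℤ N} {x : N} (hux : u x = 1) :
    ∃ (η : Module.Dual ℤ N) (e : N), η e = 1 ∧ η x = 0 ∧ u e = 0 ∧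
      ∀ n, n = η n • e + u n • x := by
  let b : Module.Basis (Fin 2) ℤ N := (Module.finBasisOfFinrankEq ℤ N hN)
  have hu : ∀ n, u n = b.coord 0 n * u (b 0) + b.coord 1 n * u (b 1) := fun n => by
    conv_lhs => rw [basis_repr_two b n]
    simp
  have hx := hu x
  rw [hux] at hx
  have h00 : b.coord 0 (b 0) = 1 := by simp
  have h01 : b.coord 0 (b 1) = 0 := by simp
  have h10 : b.coord 1 (b 0) = 0 := by simp
  have h11 : b.coord 1 (b 1) = 1 := by simp
  -- Up to sign, `η` is the determinant against `x`, and `e` is `u` turned by a right angle; then `η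
  -- e = u x = 1`.
  refine ⟨b.coord 1 x • b.coord 0 - b.coord 0 x • b.coord 1, u (b 1) • b 0 - u (b 0) • b 1,
    ?_, ?_, ?_, fun n => ?_⟩
  · simp only [LinearMap.sub_apply, LinearMap.smul_apply, map_sub, map_smul, smul_eq_mul,
      h00, h01, h10, h11]
    linarith
  · simp only [LinearMap.sub_apply, LinearMap.smul_apply, smul_eq_mul]
    ring
  · simp only [map_sub, map_smul, smul_eq_mul]
    ring
  · have hn := hu n
    simp only [LinearMap.sub_apply, LinearMap.smul_apply, smul_eq_mul]
    rw [hn]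
    generalize u (b 0) = p at *
    generalize u (b 1) = q at *
    have hxb := basis_repr_two b x
    have hnb := basis_repr_two b n
    generalize b.coord 0 x = x0 at *
    generalize b.coord 1 x = x1 at *
    generalize b.coord 0 n = n0 at *
    generalize b.coord 1 n = n1 at *
    have e0 : n0 = (x1 * n0 - x0 * n1) * q + (n0 * p + n1 * q) * x0 := by linear_combination n0 * hx
    have e1 : n1 = -(x1 * n0 - x0 * n1) * p + (n0 * p + n1 * q) * x1 := by
      linear_combination n1 * hx
    rw [hxb]
    refine hnb.trans ?_
    linear_combination (norm := module) e0 • b 0 + e1 • b 1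

variable [Module.Free ℤ N] [Module.Finite ℤ N] (hN : Module.finrank ℤ N = 2) {l : ℕ}
  {P : Set (RatSpace N)} (hP : IsReflexive l P)
include hN hP

/-- A coordinate form rescaled to have maximum `l` supports `P`, possibly only at a vertex; one
rotation about that vertex produces a true edge. -/
lemma IsReflexive.exists_edge :
    ∃ (u : Module.Dual ℤ N) (h : RatSpace N →ₗ[ℚ] ℚ) (n : N), EdgeFlag P l u h n := by
  have hl : (0 : ℚ) < l := by exact_mod_cast hP.index_pos
  obtain ⟨S, hS⟩ := hP.latticePolytope.polytope
  let b : Module.Basis (Fin 2) ℤ N := Module.finBasisOfFinrankEq ℤ N hN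
  set g := pairing (b.coord 0) with hg
  set h := pairing (b.coord 1) with hh
  have hg0 : g ≠ 0 := fun h0 => by
    have := LinearMap.congr_fun h0 (toRat (b 0))
    simp [hg] at this
  obtain ⟨s, hs, hpos⟩ := hP.exists_pos hS g hg0
  obtain ⟨m, hm, hmax⟩ := S.exists_max_image g ⟨s, hs⟩
  have hM : 0 < g m := hpos.trans_le (hmax s hs)
  obtain ⟨w, -, hw, -⟩ := exists_flag (S := S) hl.ne' (f := (l / g m) • g) (h := h)
    (fun s hs => by
      simp only [LinearMap.smul_apply, smul_eq_mul]
      rw [div_mul_eq_mul_div, div_le_iff₀ hM]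
      exact mul_le_mul_of_nonneg_left (hmax s hs) hl.le)
    ⟨m, hm, by simp [hM.ne']⟩
    (fun y h1 h2 => by
      have h1' : g y = 0 := by simpa [hl.ne', hM.ne'] using h1
      rw [ratSpace_eq_of_basis b y, ← hg, ← hh, h1', h2]
      simp)
    ⟨toRat (b 1), by simp [hg], by simp [hh]⟩
  rw [← hS] at hw
  obtain ⟨t, u, n, -, -, -, hE⟩ := hP.exists_rotate hN hw
  exact ⟨u, _, n, hE⟩

/-- If `x` is a nonzero lattice point at height at most one above each edge, then it has height
one above some edge, and its multiple `l x` lies on this edge. -/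
lemma IsReflexive.exists_edge_of_height_le_one {x : N} (hx0 : x ≠ 0)
    (hx : ∀ u : Module.Dual ℤ N, IsPrimitive u → (∀ y ∈ P, pairing u y ≤ l) → u x ≤ 1) :
    ∃ (u : Module.Dual ℤ N) (h : RatSpace N →ₗ[ℚ] ℚ) (n m : N), u x = 1 ∧ EdgeFlag P l u h n ∧
      EdgeFlag P l u (-h + (h (toRat m) / l) • pairing u) m ∧ h (toRat x) ≤ 0 ∧
        h (toRat m) ≤ l * h (toRat x) := by
  have hl : (0 : ℚ) < l := by exact_mod_cast hP.index_pos
  -- Choose the edge with the largest height `u x`; the heights are integers bounded by `1`.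
  obtain ⟨c, ⟨u, h, n, hE, rfl⟩, hmax⟩ := Int.exists_greatest_of_bdd
    (P := fun c => ∃ (u : Module.Dual ℤ N) (h : RatSpace N →ₗ[ℚ] ℚ) (n : N),
      EdgeFlag P l u h n ∧ u x = c)
    ⟨1, by rintro _ ⟨u, h, n, hE, rfl⟩; exact hx u hE.primitive hE.flag.le⟩
    (by obtain ⟨u, h, n, hE⟩ := hP.exists_edge hN; exact ⟨_, u, h, n, hE, rfl⟩)
  -- If `h'` were positive at `x`, rotating to the next edge would increase the height of `x`.
  -- Applied at both ends of the edge, this puts `x` in the cone over it.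
  have key : ∀ (h' : RatSpace N →ₗ[ℚ] ℚ) (n' : N), EdgeFlag P l u h' n' → h' (toRat x) ≤ 0 := by
    intro h' n' hE'
    obtain ⟨t, u', n₁, ht, -, hu', hE₁⟩ := hP.exists_rotate hN hE'.flag
    have h1 : (u' x : ℚ) ≤ u x := by exact_mod_cast hmax _ ⟨u', _, n₁, hE₁, rfl⟩
    have h2 := LinearMap.congr_fun hu' (toRat x)
    simp only [pairing_toRat, LinearMap.add_apply, LinearMap.smul_apply, smul_eq_mul] at h2
    by_contra! h3
    have := mul_pos ht h3
    linarith
  obtain ⟨m, hm, hEm⟩ := hP.exists_opposite hN hE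
  have h1 := key _ _ hE
  have h2 := key _ _ hEm
  simp only [LinearMap.add_apply, LinearMap.neg_apply, LinearMap.smul_apply, pairing_toRat,
    smul_eq_mul] at h2
  have hdiv : h (toRat m) / l < 0 := div_neg_of_neg_of_pos hm hl
  have hux : u x = 1 := by
    refine le_antisymm (hx u hE.primitive hE.flag.le) ?_
    -- If `u x ≤ 0`, the inequalities from the two ends force `h` and `u` to vanish at `x`, so `x =
    -- 0`.
    by_contra! hlt
    have hle : (u x : ℚ) ≤ 0 := by exact_mod_cast (by omega : u x ≤ 0)
    have h3 : 0 ≤ h (toRat m) / l * u x := mul_nonneg_of_nonpos_of_nonpos hdiv.le hle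
    have h4 : h (toRat x) = 0 := by linarith
    have h5 : (u x : ℚ) = 0 := by
      have h6 : h (toRat m) / l * u x = 0 := by linarith
      exact (mul_eq_zero.1 h6).resolve_left hdiv.ne
    exact hx0 (toRat_injective ((hE.flag.inj _ (by simpa using h5) h4).trans toRat_zero.symm))
  rw [hux, Int.cast_one, mul_one] at h2
  refine ⟨u, h, n, m, hux, hE, hEm, h1, ?_⟩
  have : h (toRat m) / l ≤ h (toRat x) := by linarith
  rw [div_le_iff₀ hl] at this
  linarith

/-- If the local index is not one, the multiple `l x` in the previous lemma is strictly between
the vertices of the edge. -/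
lemma IsReflexive.exists_edge_of_height_le_one_of_ne_one {x : N} (hx0 : x ≠ 0)
    (hx : ∀ u : Module.Dual ℤ N, IsPrimitive u → (∀ y ∈ P, pairing u y ≤ l) → u x ≤ 1)
    (hl1 : l ≠ 1) :
    ∃ (u : Module.Dual ℤ N) (h : RatSpace N →ₗ[ℚ] ℚ) (n m : N), u x = 1 ∧ EdgeFlag P l u h n ∧
      EdgeFlag P l u (-h + (h (toRat m) / l) • pairing u) m ∧ h (toRat x) < 0 ∧
        h (toRat m) < l * h (toRat x) := by
  obtain ⟨u, h, n, m, hux, hE, hEm, h1, h2⟩ := hP.exists_edge_of_height_le_one hN hx0 hx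
  have notvertex : ∀ n', IsPrimitive n' → pairing u (toRat n') = l →
      h (toRat n') = l * h (toRat x) → False := by
    intro n' hn' hu' hh'
    have : toRat n' - (l : ℚ) • toRat x = 0 :=
      hE.flag.inj _ (by rw [map_sub, map_smul, hu']; simp [hux])
        (by rw [map_sub, map_smul, hh', smul_eq_mul, sub_self])
    -- A primitive vertex cannot be `l` times a lattice point, as `l ≠ 1`.
    have hn : n' = (l : ℤ) • x := toRat_injective (by
      rw [toRat_zsmul]; exact_mod_cast sub_eq_zero.1 this)
    have := hn'.isUnit_of_zsmul hn
    rw [Int.isUnit_iff] at this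
    omega
  refine ⟨u, h, n, m, hux, hE, hEm, h1.lt_of_ne fun h0 => ?_, h2.lt_of_ne fun h0 => ?_⟩
  · exact notvertex n hE.primitive_vertex hE.flag.apply_eq (by
      rw [hE.flag.apply_eq_zero, h0, mul_zero])
  · exact notvertex m hEm.primitive_vertex hEm.flag.apply_eq h0

end Rank2

/-! ### Divisibility facts about edges in adapted coordinates. -/

section Arithmetic

/-- An edge of height `l` with primitive normal `(p, q)`, `q ≤ 0`, through the primitive point
`(b, l)`. -/
lemma edge_through_top {l b p q : ℤ} (hl : 1 < l) (hbl : IsCoprime b l) (hpq : IsCoprime p q)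
    (hq : q ≤ 0) (h : p * b + q * l = l) : l ∣ p ∧ q < 0 ∧ IsCoprime q l := by
  have hdvd : l ∣ p := by
    have : l ∣ p * b := ⟨1 - q, by linarith⟩
    exact hbl.symm.dvd_of_dvd_mul_right this
  have hc : IsCoprime q l := (hpq.of_isCoprime_of_dvd_left hdvd).symm
  refine ⟨hdvd, hq.lt_of_ne ?_, hc⟩
  rintro rfl
  rw [isCoprime_zero_left, Int.isUnit_iff] at hc
  omega

/-- Below the `x`-axis, an edge with normal `(l p, q)`, `q < 0`, bounds the abscissa. -/
lemma nonpos_of_below {l p q X Y : ℤ} (hl : 0 < l) (hdvd : l ∣ p) (hp : 0 < p) (hq : q < 0)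
    (hY : Y < 0) (h : p * X + q * Y ≤ l) : X ≤ 0 := by
  obtain ⟨k, rfl⟩ := hdvd
  have hk : 0 < k := pos_of_mul_pos_right hp hl.le
  by_contra! hX
  have h1 : 1 ≤ k * X := by nlinarith
  nlinarith [mul_pos_of_neg_of_neg hq hY]

/-- A primitive point on the second axis is `(0, ±1)`, and `l > 1` does not divide `±1`. -/
lemma false_of_coprime_zero {l X Y : ℤ} (hl : 1 < l) (hX : X = 0) (hXY : IsCoprime X Y)
    (h : l ∣ Y) : False := by
  rw [hX, isCoprime_zero_left] at hXY
  have := Int.isUnit_iff.1 (isUnit_of_dvd_unit h hXY)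
  omega

end Arithmetic

/-! ### The upper bound for the order. -/

section Rank2

variable {N : Type*} [AddCommGroup N]

/-- The gcd of the coefficients can be factored out of `x`, so it is a unit. This serves for
vertices and, in the dual lattice, for edge normals. -/
lemma IsPrimitive.isCoprime [Module.Free ℤ N] {x y z : N} {a b : ℤ} (hx : IsPrimitive x)
    (h : x = a • y + b • z) : IsCoprime a b := by
  rw [Int.isCoprime_iff_gcd_eq_one]
  have hu := hx.isUnit_of_zsmul (d := Int.gcd a b)
    (y := (a / Int.gcd a b) • y + (b / Int.gcd a b) • z) (by
      rw [smul_add, smul_smul, smul_smul, Int.mul_ediv_cancel' (Int.gcd_dvd_left ..),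
        Int.mul_ediv_cancel' (Int.gcd_dvd_right ..), h])
  rw [Int.isUnit_iff] at hu
  omega

variable [Module.Free ℤ N] [Module.Finite ℤ N] (hN : Module.finrank ℤ N = 2) {l : ℕ}
  {P : Set (RatSpace N)} (hP : IsReflexive l P)
include hN hP

/-- The origin is the only lattice point at height at most one above each edge. -/
theorem IsReflexive.eq_zero_of_height_le_one {x : N}
    (hx : ∀ u : Module.Dual ℤ N, IsPrimitive u → (∀ y ∈ P, pairing u y ≤ l) → u x ≤ 1)
    (hl1 : l ≠ 1) : x = 0 := by
  by_contra hx0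
  have hl : (1 : ℤ) < l := by have := hP.index_pos; omega
  have hlq : (0 : ℚ) < l := by exact_mod_cast hP.index_pos
  obtain ⟨u, h, n, m, hux, hE, hEm, hhx, hhm⟩ := 
    hP.exists_edge_of_height_le_one_of_ne_one hN hx0 hx hl1
  -- Points get coordinates `(η, u)`, with `e = (1, 0)` and `x = (0, 1)`. The sign of `e` is chosen
  -- so that `h` increases to the right, putting `n` at the right end of the top edge.
  obtain ⟨η, e, hηe, hηx, hue, hdec, hhe⟩ : ∃ (η : Module.Dual ℤ N) (e : N), η e = 1 ∧ η x = 0 ∧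
      u e = 0 ∧ (∀ n, n = η n • e + u n • x) ∧ 0 < h (toRat e) := by
    obtain ⟨η, e, hηe, hηx, hue, hdec⟩ := exists_complement hN hux
    rcases lt_trichotomy (h (toRat e)) 0 with h0 | h0 | h0
    · exact ⟨-η, -e, by simpa using hηe, by simpa using hηx, by simpa using hue,
        fun n => by simpa using hdec n, by simpa using h0⟩
    · have : toRat e = 0 := hE.flag.inj _ (by simp [hue]) h0
      rw [toRat_injective (this.trans toRat_zero.symm), map_zero] at hηe
      omega
    · exact ⟨η, e, hηe, hηx, hue, hdec, h0⟩
  have hval : ∀ (g : RatSpace N →ₗ[ℚ] ℚ) (y : N),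
      g (toRat y) = η y * g (toRat e) + u y * g (toRat x) := by
    intro g y
    conv_lhs => rw [hdec y]
    simp [toRat_zsmul]
  have hvalu : ∀ (v : Module.Dual ℤ N) (y : N), v y = η y * v e + u y * v x := by
    intro v y
    conv_lhs => rw [hdec y]
    simp
  have hco : ∀ y : N, IsPrimitive y → IsCoprime (η y) (u y) := fun y hy => hy.isCoprime (hdec y)
  -- In the dual basis `η`, `u`, the normal `v` has coordinates `(v e, v x)`.
  have hcou : ∀ v : Module.Dual ℤ N, IsPrimitive v → IsCoprime (v e) (v x) := fun v hv =>
    hv.isCoprime (y := η) (z := u) (LinearMap.ext fun y => by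
      rw [hvalu v y]; simp; ring)
  have happ : ∀ {v : Module.Dual ℤ N} {g : RatSpace N →ₗ[ℚ] ℚ} {y : N}, EdgeFlag P l v g y →
      v y = l := fun H => by
    have := H.flag.apply_eq
    rw [pairing_toRat] at this
    exact_mod_cast this
  have hbd : ∀ {v : Module.Dual ℤ N} {g g' : RatSpace N →ₗ[ℚ] ℚ} {y y' : N} {v' : Module.Dual ℤ N},
      EdgeFlag P l v g y → EdgeFlag P l v' g' y' → v y' ≤ l := fun H H' => by
    have := H.flag.le _ H'.flag.mem
    rw [pairing_toRat] at this
    exact_mod_cast this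
  have hun := happ hE
  have hum := happ hEm
  -- the edge after `n`
  obtain ⟨t₁, u₁, s, ht₁, hhs, hu₁, hE₁⟩ := hP.exists_rotate hN hE.flag
  have hu₁' : ∀ y, (u₁ y : ℚ) = u y + t₁ * h (toRat y) := fun y => by
    simpa using LinearMap.congr_fun hu₁ (toRat y)
  have hu₁e : 0 < u₁ e := by
    have := hu₁' e
    rw [hue] at this
    have h1 := mul_pos ht₁ hhe
    exact_mod_cast (show (0 : ℚ) < u₁ e by push_cast at this; linarith)
  have hu₁x : u₁ x ≤ 0 := by
    have := hu₁' x
    rw [hux] at this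
    have h1 := mul_neg_of_pos_of_neg ht₁ hhx
    have h2 : (u₁ x : ℚ) < 1 := by push_cast at this; linarith
    have : u₁ x < 1 := by exact_mod_cast h2
    omega
  have hu₁n : u₁ n = l := by
    have := hu₁' n
    rw [hE.flag.apply_eq_zero, mul_zero, add_zero, hun] at this
    exact_mod_cast this
  -- the edge before `m`
  obtain ⟨t₂, u₂, s₂, ht₂, -, hu₂, hE₂⟩ := hP.exists_rotate hN hEm.flag
  have hu₂' : ∀ y, (u₂ y : ℚ) = u y + t₂ * (-h (toRat y) + h (toRat m) / l * u y) := fun y => by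
    simpa [mul_add] using LinearMap.congr_fun hu₂ (toRat y)
  have hu₂e : u₂ e < 0 := by
    have := hu₂' e
    rw [hue] at this
    have h1 := mul_pos ht₂ hhe
    exact_mod_cast (show (u₂ e : ℚ) < 0 by push_cast at this; linarith)
  have hu₂x : u₂ x ≤ 0 := by
    have := hu₂' x
    rw [hux, Int.cast_one, mul_one] at this
    have h0 : h (toRat m) / l < h (toRat x) := by rw [div_lt_iff₀ hlq]; linarith
    have h1 := mul_neg_of_pos_of_neg ht₂ (sub_neg.2 h0)
    have h2 : (u₂ x : ℚ) < 1 := by linarith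
    have : u₂ x < 1 := by exact_mod_cast h2
    omega
  have hu₂m : u₂ m = l := by
    have := hu₂' m
    rw [hum] at this
    push_cast at this
    rw [div_mul_cancel₀ _ hlq.ne', neg_add_cancel, mul_zero, add_zero] at this
    exact_mod_cast this
  have hcn := hco n hE.primitive_vertex
  have hcm := hco m hEm.primitive_vertex
  rw [hun] at hcn
  rw [hum] at hcm
  obtain ⟨hd₁, hq₁, hc₁⟩ := edge_through_top hl hcn (hcou u₁ hE₁.primitive) hu₁x (by
    have := hvalu u₁ n
    rw [hu₁n, hun] at this
    linarith)
  obtain ⟨hd₂, hq₂, -⟩ := edge_through_top hl hcm (hcou u₂ hE₂.primitive) hu₂x (by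
    have := hvalu u₂ m
    rw [hu₂m, hum] at this
    linarith)
  -- below the axis the abscissa vanishes
  have hbelow : ∀ {v : Module.Dual ℤ N} {g : RatSpace N →ₗ[ℚ] ℚ} {y : N}, EdgeFlag P l v g y →
      u y < 0 → η y = 0 := by
    intro v g y H hy
    have h1 := hbd hE₁ H
    have h2 := hbd hE₂ H
    rw [hvalu] at h1 h2
    have h3 := nonpos_of_below (by omega) hd₁ hu₁e hq₁ hy (by linarith)
    have h4 := nonpos_of_below (X := -η y) (by omega) ((dvd_neg (α := ℤ)).2 hd₂)
      (by omega : 0 < -u₂ e) hq₂ hy (by linarith)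
    omega
  -- the other end of the edge after `n` is `(1, 0)`
  have hu₁s := happ hE₁
  have hs := hvalu u₁ s
  rw [hu₁s] at hs
  -- The edge equation is `η s * p + u s * q = l` with `l ∣ p`, and `q` is coprime to `l`.
  have hds : (l : ℤ) ∣ u s := by
    obtain ⟨k, hk⟩ := hd₁
    have : (l : ℤ) ∣ u s * u₁ x := ⟨1 - η s * k, by rw [hk] at hs; linarith⟩
    exact hc₁.symm.dvd_of_dvd_mul_right this
  have hs0 : u s = 0 := by
    rcases lt_trichotomy (u s) 0 with h0 | h0 | h0
    · exact (false_of_coprime_zero hl (hbelow hE₁ h0) (hco s hE₁.primitive_vertex) hds).elim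
    · exact h0
    -- A positive multiple of `l` that is at most `l` puts `s` on the top edge, beyond its end `n`.
    · have h1 : u s = l := le_antisymm (hbd hE hE₁) (Int.le_of_dvd h0 hds)
      have := hE.flag.nonpos _ hE₁.flag.mem (by rw [pairing_toRat, h1]; norm_cast)
      linarith
  rw [hs0, zero_mul, add_zero] at hs
  -- Now `l = η s * u₁ e` with `l ∣ u₁ e`.
  have hu₁el : u₁ e = l ∧ η s = 1 := by
    have h1 := Int.le_of_dvd hu₁e hd₁
    have h2 : 0 < η s := by
      by_contra! h0
      nlinarith
    have h3 : η s = 1 := by nlinarith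
    rw [h3] at hs
    exact ⟨by linarith, h3⟩
  -- the next edge
  obtain ⟨t₃, u₃, r, ht₃, hhr, hu₃, hE₃⟩ := hP.exists_rotate hN hE₁.flag
  set h₃ := h - (h (toRat s) / l) • pairing u₁ with hh₃
  have h₃s : h₃ (toRat s) = 0 := hE₁.flag.apply_eq_zero
  have h₃n : h₃ (toRat n) < 0 := by
    simp only [hh₃, LinearMap.sub_apply, LinearMap.smul_apply, hE.flag.apply_eq_zero, pairing_toRat,
      hu₁n, smul_eq_mul]
    push_cast
    rw [div_mul_cancel₀ _ hlq.ne']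
    linarith
  have h₃e : h₃ (toRat e) = 0 := by
    have := hval h₃ s
    rw [h₃s, hs0, hu₁el.2] at this
    push_cast at this
    linarith
  have h₃x : h₃ (toRat x) < 0 := by
    have := hval h₃ n
    rw [h₃e, hun] at this
    push_cast at this
    by_contra! h0
    have := mul_nonneg hlq.le h0
    linarith
  have hu₃' : ∀ y, (u₃ y : ℚ) = u₁ y + t₃ * h₃ (toRat y) := fun y => by
    simpa using LinearMap.congr_fun hu₃ (toRat y)
  have hu₃e : u₃ e = l := by
    have := hu₃' e
    rw [h₃e, mul_zero, add_zero, hu₁el.1] at this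
    exact_mod_cast this
  -- `h₃` vanishes at `e` and is negative at `x`, so moving on from `s` means going below the first
  -- axis.
  have hur : u r < 0 := by
    have := hval h₃ r
    rw [h₃e, mul_zero, zero_add] at this
    rw [this] at hhr
    exact_mod_cast neg_of_mul_pos_left hhr h₃x.le
  have hr := hvalu u₃ r
  have hcr := hcou u₃ hE₃.primitive
  rw [happ hE₃, hu₃e, hbelow hE₃ hur] at hr
  rw [hu₃e] at hcr
  refine false_of_coprime_zero hl (hbelow hE₃ hur) (hco r hE₃.primitive_vertex) ?_
  -- With `η r = 0` the edge equation reads `l = u r * u₃ x`, and `u₃ x` is coprime to `u₃ e = l`.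
  exact hcr.dvd_of_dvd_mul_right ⟨1, by linarith⟩

/-- Half the local index, rounded up, belongs to the order set. -/
theorem IsReflexive.half_mem_orderSet : (l + 1) / 2 ∈ orderSet P := by
  have hl := hP.index_pos
  have hk : 0 < (l + 1) / 2 := by omega
  have hkq : (0 : ℚ) < ((l + 1) / 2 : ℕ) := by exact_mod_cast hk
  have hint : interiorQ ((((l + 1) / 2 : ℕ) : ℚ)⁻¹ • P) =
      (((l + 1) / 2 : ℕ) : ℚ)⁻¹ • interiorQ P := interiorQ_smul (inv_ne_zero hkq.ne')
  refine ⟨hk, Set.Subset.antisymm ?_ ?_⟩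
  · rintro _ ⟨hx, x, rfl⟩
    rw [hint, Set.mem_inv_smul_set_iff₀ hkq.ne'] at hx
    have hlt : ∀ u : Module.Dual ℤ N, IsPrimitive u → (∀ y ∈ P, pairing u y ≤ l) →
        (((l + 1) / 2 : ℕ) : ℤ) * u x < l := by
      intro u hu hle
      have hu0 : pairing u ≠ 0 := fun h0 => hu.1 <| LinearMap.ext fun y => by
        have := LinearMap.congr_fun h0 (toRat y)
        simpa using this
      have := lt_of_mem_interiorQ hx hu0 hle
      rw [map_smul, pairing_toRat, smul_eq_mul] at this
      have h2 : ((((l + 1) / 2 : ℕ) : ℤ) : ℚ) * u x < (l : ℤ) := by rwa [Int.cast_natCast]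
      exact_mod_cast h2
    have hx0 : x = 0 := by
      -- For `l = 1` height one is already excluded strictly, while a nonzero `x` would attain it
      -- over some edge.
      by_cases hl1 : l = 1
      · subst hl1
        by_contra hne
        have hlt' : ∀ u : Module.Dual ℤ N, IsPrimitive u →
            (∀ y ∈ P, pairing u y ≤ (1 : ℕ)) → u x < 1 := fun u hu hle => by
          simpa using hlt u hu hle
        obtain ⟨u, h, n, m, hux, hE, -⟩ :=
          hP.exists_edge_of_height_le_one hN hne fun u hu hle => (hlt' u hu hle).le
        exact (hlt' u hE.primitive hE.flag.le).ne hux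
      · refine hP.eq_zero_of_height_le_one hN (fun u hu hle => ?_) hl1
        have := hlt u hu hle
        by_contra! h2
        -- The rounding is harmless: `2 * ((l + 1) / 2)` is `l` or `l + 1`, so `u x ≥ 2` contradicts
        -- the strict bound.
        have h3 : (l : ℤ) ≤ (((l + 1) / 2 : ℕ) : ℤ) * 2 := by push_cast; omega
        nlinarith
    rw [hx0]
    simp
  · rintro _ rfl
    refine ⟨?_, 0, by simp⟩
    rw [hint, Set.mem_inv_smul_set_iff₀ hkq.ne', smul_zero]
    exact hP.zero_mem_interior

end Rank2

/-! ### The hexagon in the basis `vertexA`, `vertexB l`: inequalities and vertices. -/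

section Hexagon

/-- The integral form `(x, y) ↦ a x + b y` on `ℤ²`. -/
def form (a b : ℤ) : Module.Dual ℤ (Fin 2 → ℤ) := a • LinearMap.proj 0 + b • LinearMap.proj 1

@[simp]
lemma form_apply (a b : ℤ) (x : Fin 2 → ℤ) : form a b x = a * x 0 + b * x 1 := by
  simp [form]

lemma ratSpace_eq (y : RatSpace (Fin 2 → ℤ)) :
    y = pairing (form 1 0) y • toRat ![1, 0] + pairing (form 0 1) y • toRat ![0, 1] := by
  have h0 : (Pi.basisFun ℤ (Fin 2)).coord 0 = form 1 0 := by ext i; fin_cases i <;> simp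
  have h1 : (Pi.basisFun ℤ (Fin 2)).coord 1 = form 0 1 := by ext i; fin_cases i <;> simp
  have e0 : Pi.basisFun ℤ (Fin 2) 0 = ![1, 0] := by ext i; fin_cases i <;> simp
  have e1 : Pi.basisFun ℤ (Fin 2) 1 = ![0, 1] := by ext i; fin_cases i <;> simp
  have := ratSpace_eq_of_basis (Pi.basisFun ℤ (Fin 2)) y
  rwa [h0, h1, e0, e1] at this

/-- The vertex `(0, 1)` of the hexagon. -/
def vertexA : RatSpace (Fin 2 → ℤ) := toRat ![0, 1]

/-- The vertex `(l, 1)` of the hexagon. -/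
def vertexB (l : ℕ) : RatSpace (Fin 2 → ℤ) := toRat ![(l : ℤ), 1]

/-- The coordinate dual to `vertexA` with respect to the basis `vertexA`, `vertexB l`. -/
noncomputable def coordA (l : ℕ) : RatSpace (Fin 2 → ℤ) →ₗ[ℚ] ℚ :=
  pairing (form 0 1) - (l : ℚ)⁻¹ • pairing (form 1 0)

/-- The coordinate dual to `vertexB l` with respect to the basis `vertexA`, `vertexB l`. -/
noncomputable def coordB (l : ℕ) : RatSpace (Fin 2 → ℤ) →ₗ[ℚ] ℚ :=
  (l : ℚ)⁻¹ • pairing (form 1 0)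

/-- The vertices of the hexagon in terms of `vertexA` and `vertexB l`. -/
def hexagonVertices (l : ℕ) : Set (RatSpace (Fin 2 → ℤ)) :=
  {vertexA, -vertexA, vertexA + vertexB l, -(vertexA + vertexB l), vertexB l, -vertexB l}

lemma image_toRat_eq_hexagonVertices (l : ℕ) :
    toRat '' ({![0, 1], ![0, -1], ![(l : ℤ), 2], ![-(l : ℤ), -2], ![(l : ℤ), 1],
      ![-(l : ℤ), -1]} : Set (Fin 2 → ℤ)) = hexagonVertices l := by
  simp only [Set.image_insert_eq, Set.image_singleton, hexagonVertices, vertexA, vertexB,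
    ← toRat_neg, ← toRat_add]
  simp

lemma hexagon_eq (l : ℕ) : hexagon l = convexHull ℚ (hexagonVertices l) := by
  rw [hexagon, image_toRat_eq_hexagonVertices]

lemma forall_mem_hexagonVertices {l : ℕ} {p : RatSpace (Fin 2 → ℤ) → Prop} :
    (∀ s ∈ hexagonVertices l, p s) ↔ p vertexA ∧ p (-vertexA) ∧ p (vertexA + vertexB l) ∧
      p (-(vertexA + vertexB l)) ∧ p (vertexB l) ∧ p (-vertexB l) := by
  simp [hexagonVertices]

lemma mem_hexagon {l : ℕ} {s : RatSpace (Fin 2 → ℤ)} (hs : s ∈ hexagonVertices l) :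
    s ∈ hexagon l := hexagon_eq l ▸ subset_convexHull ℚ _ hs

variable {l : ℕ} (hl : 0 < l)

@[simp]
lemma coordA_vertexA : coordA l vertexA = 1 := by simp [coordA, vertexA]

@[simp]
lemma coordB_vertexA : coordB l vertexA = 0 := by simp [coordB, vertexA]

include hl

lemma coordA_vertexB : coordA l (vertexB l) = 0 := by simp [coordA, vertexB, hl.ne']

lemma coordB_vertexB : coordB l (vertexB l) = 1 := by simp [coordB, vertexB, hl.ne']

lemma eq_coord (y : RatSpace (Fin 2 → ℤ)) :
    y = coordA l y • vertexA + coordB l y • vertexB l := by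
  have hB : vertexB l = (l : ℚ) • toRat ![1, 0] + toRat ![0, 1] := by
    have := toRat_zsmul (l : ℤ) (![1, 0] : Fin 2 → ℤ)
    rw [Int.cast_natCast] at this
    rw [← this, ← toRat_add]
    simp [vertexB]
  have hlq : (l : ℚ) ≠ 0 := by exact_mod_cast hl.ne'
  conv_lhs => rw [ratSpace_eq y]
  simp only [coordA, coordB, LinearMap.sub_apply, LinearMap.smul_apply, smul_eq_mul, hB, vertexA,
    smul_add, smul_smul]
  rw [mul_comm (l : ℚ)⁻¹, mul_assoc, inv_mul_cancel₀ hlq, mul_one]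
  module

lemma ext_coord {f g : RatSpace (Fin 2 → ℤ) →ₗ[ℚ] ℚ} (hA : f vertexA = g vertexA)
    (hB : f (vertexB l) = g (vertexB l)) : f = g := by
  refine LinearMap.ext fun y => ?_
  rw [eq_coord hl y]
  simp [hA, hB]

omit hl in
lemma convex_comb_mem {V : Type*} [AddCommGroup V] [Module ℚ V] {C : Set V} (hC : Convex ℚ C)
    (h0 : (0 : V) ∈ C) {a b : V} (ha : a ∈ C) (hb : b ∈ C) {s t : ℚ} (hs : 0 ≤ s) (ht : 0 ≤ t)
    (hst : s + t ≤ 1) : s • a + t • b ∈ C := by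
  rcases (add_nonneg hs ht).eq_or_lt with h | h
  · obtain rfl : s = 0 := by linarith
    obtain rfl : t = 0 := by linarith
    simpa using h0
  · have h1 := hC ha hb (div_nonneg hs h.le) (div_nonneg ht h.le) (by field_simp)
    have h2 := hC.smul_mem_of_zero_mem h0 h1 ⟨h.le, hst⟩
    rwa [smul_add, smul_smul, smul_smul, mul_div_cancel₀ _ h.ne', mul_div_cancel₀ _ h.ne'] at h2

omit hl in
lemma zero_mem_hexagon : (0 : RatSpace (Fin 2 → ℤ)) ∈ hexagon l := by
  have h1 : vertexA ∈ hexagon l := mem_hexagon (by simp [hexagonVertices])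
  have h2 : -vertexA ∈ hexagon l := mem_hexagon (by simp [hexagonVertices])
  have := (convex_convexHull ℚ _ : Convex ℚ (hexagon l)) h1 h2 (a := 1 / 2) (b := 1 / 2)
    (by norm_num) (by norm_num) (by norm_num)
  rwa [smul_neg, add_neg_cancel] at this

/-- The signs and the order of the two coordinates select one of the six triangles spanned by the
origin and two consecutive vertices; there `y` is an explicit combination. -/
lemma mem_hexagon_of_coord {y : RatSpace (Fin 2 → ℤ)} (hA : |coordA l y| ≤ 1)
    (hB : |coordB l y| ≤ 1) (hAB : |coordA l y - coordB l y| ≤ 1) : y ∈ hexagon l := by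
  have hC : Convex ℚ (hexagon l) := convex_convexHull ℚ _
  have h0 := zero_mem_hexagon (l := l)
  obtain ⟨h1, h2, h3, h4, h5, h6⟩ := forall_mem_hexagonVertices.1 fun s hs => mem_hexagon (l := l) hs
  rw [eq_coord hl y]
  generalize coordA l y = α at *
  generalize coordB l y = β at *
  rw [abs_le] at hA hB hAB
  rcases le_total 0 α with ha | ha <;> rcases le_total 0 β with hb | hb
  · rcases le_total α β with hab | hab
    · convert convex_comb_mem hC h0 h3 h5 ha (sub_nonneg.2 hab) (by linarith) using 1
      module
    · convert convex_comb_mem hC h0 h3 h1 hb (sub_nonneg.2 hab) (by linarith) using 1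
      module
  · convert convex_comb_mem hC h0 h1 h6 ha (neg_nonneg.2 hb) (by linarith) using 1
    module
  · convert convex_comb_mem hC h0 h2 h5 (neg_nonneg.2 ha) hb (by linarith) using 1
    module
  · rcases le_total α β with hab | hab
    · convert convex_comb_mem hC h0 h4 h2 (neg_nonneg.2 hb) (sub_nonneg.2 hab) (by linarith) using 1
      module
    · convert convex_comb_mem hC h0 h4 h6 (neg_nonneg.2 ha) (sub_nonneg.2 hab) (by linarith) using 1
      module

lemma mem_interiorQ_hexagon {y : RatSpace (Fin 2 → ℤ)} (hA : |coordA l y| < 1)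
    (hB : |coordB l y| < 1) (hAB : |coordA l y - coordB l y| < 1) : y ∈ interiorQ (hexagon l) := by
  let : TopologicalSpace (RatSpace (Fin 2 → ℤ)) := moduleTopology ℚ _
  have : IsModuleTopology ℚ (RatSpace (Fin 2 → ℤ)) := ⟨rfl⟩
  have cA : Continuous (coordA l) := IsModuleTopology.continuous_of_linearMap _
  have cB : Continuous (coordB l) := IsModuleTopology.continuous_of_linearMap _
  have ho : IsOpen {y : RatSpace (Fin 2 → ℤ) | |coordA l y| < 1 ∧ |coordB l y| < 1 ∧
      |coordA l y - coordB l y| < 1} :=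
    (isOpen_lt cA.abs continuous_const).inter
      ((isOpen_lt cB.abs continuous_const).inter (isOpen_lt (cA.sub cB).abs continuous_const))
  exact interior_maximal (fun z hz => mem_hexagon_of_coord hl hz.1.le hz.2.1.le hz.2.2.le) ho
    ⟨hA, hB, hAB⟩

lemma zero_mem_interiorQ_hexagon : (0 : RatSpace (Fin 2 → ℤ)) ∈ interiorQ (hexagon l) :=
  mem_interiorQ_hexagon hl (by simp) (by simp) (by simp)

lemma vectorSpan_hexagon : vectorSpan ℚ (hexagon l) = ⊤ := by
  obtain ⟨h1, -, -, -, h5, -⟩ := forall_mem_hexagonVertices.1 fun s hs => mem_hexagon (l := l) hs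
  have h1' := vsub_mem_vectorSpan ℚ h1 (zero_mem_hexagon (l := l))
  have h5' := vsub_mem_vectorSpan ℚ h5 (zero_mem_hexagon (l := l))
  rw [vsub_eq_sub, sub_zero] at h1' h5'
  refine eq_top_iff.2 fun y _ => ?_
  rw [eq_coord hl y]
  exact add_mem (Submodule.smul_mem _ _ h1') (Submodule.smul_mem _ _ h5')

lemma vertices_hexagon : vertices (hexagon l) = hexagonVertices l := by
  refine Set.Subset.antisymm (hexagon_eq l ▸ extremePoints_convexHull_subset) ?_
  have hA := coordA_vertexB hl
  have hB := coordB_vertexB hl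
  -- Each vertex is the lexicographic maximum of a suitable pair of signed coordinates.
  have key : ∀ (f h : RatSpace (Fin 2 → ℤ) →ₗ[ℚ] ℚ) (w : RatSpace (Fin 2 → ℤ)),
      w ∈ hexagonVertices l → (∀ s ∈ hexagonVertices l, f s ≤ f w) →
      (∀ s ∈ hexagonVertices l, f s = f w → h s ≤ h w) →
      (∀ y, f y = 0 → h y = 0 → coordA l y = 0 ∧ coordB l y = 0) → w ∈ vertices (hexagon l) := by
    intro f h w hw hf hh hinj
    rw [hexagon_eq]
    refine mem_extremePoints_of_lex (f := f) (h := h) (subset_convexHull ℚ _ hw)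
      (fun y hy => le_of_mem_convexHull hf hy)
      (fun y hy hfy => le_of_mem_face_convexHull hf hh hy hfy) fun y h1 h2 => ?_
    obtain ⟨h3, h4⟩ := hinj y h1 h2
    rw [eq_coord hl y, h3, h4]
    simp
  have hS := @forall_mem_hexagonVertices l
  have hm := hS.1 fun s hs => hs
  refine hS.2 ⟨key (coordA l) (-coordB l) _ hm.1 ?_ ?_ ?_, key (-coordA l) (coordB l) _ hm.2.1 ?_ ?_ ?_,
    key (coordA l) (coordB l) _ hm.2.2.1 ?_ ?_ ?_, key (-coordA l) (-coordB l) _ hm.2.2.2.1 ?_ ?_ ?_,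
    key (coordB l) (-coordA l) _ hm.2.2.2.2.1 ?_ ?_ ?_,
    key (-coordB l) (coordA l) _ hm.2.2.2.2.2 ?_ ?_ ?_⟩
  all_goals first
    | exact fun y h1 h2 => ⟨by simpa using h1, by simpa using h2⟩
    | exact fun y h1 h2 => ⟨by simpa using h2, by simpa using h1⟩
    | (rw [hS]
       simp only [LinearMap.neg_apply, map_add, map_neg, hA, hB, coordA_vertexA, coordB_vertexA]
       norm_num)

lemma ncard_hexagonVertices : (hexagonVertices l).ncard = 6 := by
  have hlz : (l : ℤ) ≠ 0 := by exact_mod_cast hl.ne'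
  have hlz' : ¬ (l : ℤ) = -l := by omega
  have hlz'' : ¬ -(l : ℤ) = l := by omega
  rw [← image_toRat_eq_hexagonVertices, Set.ncard_image_of_injective _ toRat_injective]
  repeat rw [Set.ncard_insert_of_notMem (by simp [hl.ne', hlz', hlz'', hlz.symm])]
  simp

end Hexagon

/-! ### Edges of the hexagon, its reflexivity, and the lower bound for its order. -/

section Hexagon

variable {l : ℕ}

/-- If a linear form attains its maximum over the generators of a convex hull at no more than one
of them, then its maximal face is no more than this point. -/
lemma face_subset_singleton {V : Type*} [AddCommGroup V] [Module ℚ V] {S : Set V}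
    {f : V →ₗ[ℚ] ℚ} {M : ℚ} (hf : ∀ s ∈ S, f s ≤ M) {s₀ : V} (h : ∀ s ∈ S, f s = M → s = s₀)
    {α β : V →ₗ[ℚ] ℚ} (hinj : ∀ y, α y = 0 → β y = 0 → y = 0) {y : V}
    (hy : y ∈ convexHull ℚ S) (hfy : f y = M) : y = s₀ := by
  have key : ∀ g : V →ₗ[ℚ] ℚ, g (y - s₀) = 0 := by
    intro g
    have h1 := le_of_mem_face_convexHull (h := g) (c := g s₀) hf
      (fun s hs hsM => (congrArg g (h s hs hsM)).le) hy hfy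
    have h2 := le_of_mem_face_convexHull (h := -g) (c := -g s₀) hf
      (fun s hs hsM => by rw [h s hs hsM, LinearMap.neg_apply]) hy hfy
    rw [LinearMap.neg_apply] at h2
    rw [map_sub]
    linarith
  exact sub_eq_zero.1 (hinj _ (key α) (key β))

lemma isPrimitive_form {a b c d : ℤ} (h : a * c + b * d = 1) : IsPrimitive (form a b) :=
  isPrimitive_of_apply_eq_one (Module.Dual.eval ℤ _ ![c, d]) (by simpa using h)

/-- `hA` and `hB` say that `M • pairing (form a b)` and `l • f` agree on a basis, so `f = M` and
`form a b = l` cut out the same edge; `c`, `d` are Bézout coefficients witnessing primitivity. -/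
lemma hasLocalIndex_hexagon (hl : 0 < l) {f : RatSpace (Fin 2 → ℤ) →ₗ[ℚ] ℚ} {M : ℚ} (hM : 0 < M)
    {a b : ℤ} (c d : ℤ) (h : a * c + b * d = 1) (hA : (b : ℚ) * M = l * f vertexA)
    (hB : (a * l + b : ℚ) * M = l * f (vertexB l)) :
    HasLocalIndex (hexagon l) {x ∈ hexagon l | f x = M} l := by
  have hlq : (0 : ℚ) < l := by exact_mod_cast hl
  refine ⟨hl, form a b, isPrimitive_form h, ?_⟩
  have hpair : f = (M / l) • pairing (form a b) := by
    refine ext_coord hl ?_ ?_ <;> simp only [LinearMap.smul_apply, smul_eq_mul, vertexA, vertexB,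
      pairing_toRat, form_apply] at hA hB ⊢
    · field_simp
      simp
      linarith
    · field_simp
      simp
      linarith
  ext x
  refine and_congr_right fun _ => ?_
  rw [hpair, LinearMap.smul_apply, smul_eq_mul, div_mul_eq_mul_div, div_eq_iff hlq.ne']
  exact mul_right_inj' hM.ne'

lemma localIndex_hexagon (hl : Odd l) {F : Set (RatSpace (Fin 2 → ℤ))}
    (hF : IsFacet (hexagon l) F) : HasLocalIndex (hexagon l) F l := by
  have hl0 : 0 < l := hl.pos
  obtain ⟨k, hk⟩ := hl
  have hkz : (l : ℤ) = 2 * k + 1 := by exact_mod_cast hk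
  obtain ⟨⟨x₀, hx₀⟩, ⟨f, hf⟩, hdim⟩ := hF
  have hrk : Module.finrank ℚ (RatSpace (Fin 2 → ℤ)) = 2 := by rw [Module.finrank_baseChange]; simp
  rw [hf] at hx₀
  obtain ⟨hx₀, hmax⟩ := hx₀
  obtain ⟨M, hM⟩ : ∃ M, M = f x₀ := ⟨_, rfl⟩
  have hFM : F = {x ∈ hexagon l | f x = M} := by
    rw [hf]
    ext x
    refine and_congr_right fun hx => ⟨fun h => ?_, fun h y hy => ?_⟩
    · exact le_antisymm (hM ▸ hmax x hx) (hM ▸ h x₀ hx₀)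
    · rw [h, hM]
      exact hmax y hy
  have hle : ∀ s ∈ hexagonVertices l, f s ≤ M := fun s hs => hM ▸ hmax s (mem_hexagon hs)
  have hMnn : 0 ≤ M := by
    have := hmax 0 zero_mem_hexagon
    rwa [map_zero, ← hM] at this
  -- By dimension, a facet cannot reduce to one point, so the maximum is attained at two different
  -- generators.
  have hne : ∀ s₀, ¬ ∀ s ∈ hexagonVertices l, f s = M → s = s₀ := by
    intro s₀ h
    have hsub : F.Subsingleton := by
      rw [hFM]
      have : ∀ y ∈ {x ∈ hexagon l | f x = M}, y = s₀ := fun y hy =>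
        face_subset_singleton hle h (α := coordA l) (β := coordB l)
          (fun y h1 h2 => by rw [eq_coord hl0 y, h1, h2]; simp) (hexagon_eq l ▸ hy.1) hy.2
      exact fun y hy z hz => (this y hy).trans (this z hz).symm
    rw [vectorSpan_of_subsingleton ℚ hsub, finrank_bot, hrk] at hdim
    omega
  have hMpos : 0 < M := by
    refine hMnn.lt_of_ne fun h0 => ?_
    have hf0 : f = 0 := by
      obtain ⟨h1, h2, -, -, h5, h6⟩ := forall_mem_hexagonVertices.1 hle
      rw [map_neg] at h2 h6
      refine ext_coord hl0 ?_ ?_ <;> rw [LinearMap.zero_apply] <;> linarith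
    have : F = hexagon l := by
      rw [hFM, hf0, ← h0]
      simp
    rw [this, vectorSpan_hexagon hl0, finrank_top, hrk] at hdim
    omega
  obtain ⟨h1, h2, h3, h4, h5, h6⟩ := forall_mem_hexagonVertices.1 hle
  have hu : ∀ s₀, ¬ _ := fun s₀ h => hne s₀ (forall_mem_hexagonVertices.2 h)
  have key := fun a b => hasLocalIndex_hexagon hl0 (f := f) hMpos (a := a) (b := b)
  rw [hFM]
  clear hne hle hf hFM hmax hdim
  simp only [map_add, map_neg] at h1 h2 h3 h4 h5 h6 hu
  generalize hA : f vertexA = A at *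
  generalize hB : f (vertexB l) = B at *
  -- The six generators take the values `±A`, `±(A + B)`, `±B`, all at most `M`. Two of them reach
  -- `M` only for six pairs `(A, B)`, one per edge; every other pair leaves at most one maximal
  -- generator, against `hu`.
  by_cases hAM : A = M
  · by_cases hB0 : B = 0
    · refine key (-1) l (-1) 0 (by ring) ?_ ?_ <;> push_cast <;> simp [hAM, hB0]
    by_cases hBM : B = -M
    -- The normal `(-2, l)` is primitive only because `l = 2k + 1` is odd.
    · refine key (-2) l k 1 (by rw [hkz]; ring) ?_ ?_ <;> push_cast <;>
        simp only [hAM, hBM] <;> ring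
    have : B < 0 := lt_of_le_of_ne (by linarith) hB0
    have : -M < B := lt_of_le_of_ne (by linarith) (Ne.symm hBM)
    exact absurd ⟨fun _ => rfl, fun h => by linarith, fun h => by linarith, fun h => by linarith,
      fun h => by linarith, fun h => by linarith⟩ (hu vertexA)
  by_cases hAM' : A = -M
  · by_cases hB0 : B = 0
    · refine key 1 (-l) 1 0 (by ring) ?_ ?_ <;> push_cast <;> simp [hAM', hB0]
    by_cases hBM : B = M
    · refine key 2 (-l) (-k) (-1) (by rw [hkz]; ring) ?_ ?_ <;> push_cast <;>
        simp only [hAM', hBM] <;> ring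
    have : 0 < B := lt_of_le_of_ne (by linarith) (Ne.symm hB0)
    have : B < M := lt_of_le_of_ne (by linarith) hBM
    exact absurd ⟨fun h => by linarith, fun _ => rfl, fun h => by linarith, fun h => by linarith,
      fun h => by linarith, fun h => by linarith⟩ (hu (-vertexA))
  have hA1 : A < M := lt_of_le_of_ne h1 hAM
  have hA2 : -M < A := lt_of_le_of_ne (by linarith) (Ne.symm hAM')
  by_cases hBM : B = M
  · by_cases hA0 : A = 0
    · refine key 1 0 1 0 (by ring) ?_ ?_ <;> push_cast <;> simp [hBM, hA0]
    have : A < 0 := lt_of_le_of_ne (by linarith) hA0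
    exact absurd ⟨fun h => by linarith, fun h => by linarith, fun h => by linarith,
      fun h => by linarith, fun _ => rfl, fun h => by linarith⟩ (hu (vertexB l))
  by_cases hBM' : B = -M
  · by_cases hA0 : A = 0
    · refine key (-1) 0 (-1) 0 (by ring) ?_ ?_ <;> push_cast <;> simp [hBM', hA0]
    have : 0 < A := lt_of_le_of_ne (by linarith) (Ne.symm hA0)
    exact absurd ⟨fun h => by linarith, fun h => by linarith, fun h => by linarith,
      fun h => by linarith, fun h => by linarith, fun _ => rfl⟩ (hu (-vertexB l))
  have hB1 : B < M := lt_of_le_of_ne h5 hBM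
  have hB2 : -M < B := lt_of_le_of_ne (by linarith) (Ne.symm hBM')
  rcases le_total 0 (A + B) with h0 | h0
  · exact absurd ⟨fun h => by linarith, fun h => by linarith, fun _ => rfl, fun h => by linarith,
      fun h => by linarith, fun h => by linarith⟩ (hu (vertexA + vertexB l))
  · exact absurd ⟨fun h => by linarith, fun h => by linarith, fun h => by linarith, fun _ => rfl,
      fun h => by linarith, fun h => by linarith⟩ (hu (-(vertexA + vertexB l)))

theorem isReflexive_hexagon (hl : Odd l) : IsReflexive l (hexagon l) where
  index_pos := hl.pos
  latticePolytope := by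
    classical
    refine ⟨⟨{vertexA, -vertexA, vertexA + vertexB l, -(vertexA + vertexB l), vertexB l,
      -vertexB l}, by rw [hexagon_eq, hexagonVertices]; simp⟩, ?_, ?_⟩
    · rw [AffineSubspace.affineSpan_eq_top_iff_vectorSpan_eq_top_of_nonempty _ _ _
        ⟨0, zero_mem_hexagon⟩, vectorSpan_hexagon hl.pos]
    · rw [vertices_hexagon hl.pos, ← image_toRat_eq_hexagonVertices]
      rintro _ ⟨x, -, rfl⟩
      exact ⟨x, rfl⟩
  zero_mem_interior := zero_mem_interiorQ_hexagon hl.pos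
  vertices_primitive := by
    intro x hx
    obtain ⟨k, hk⟩ := hl
    have hkz : (l : ℤ) = 2 * k + 1 := by exact_mod_cast hk
    rw [vertices_hexagon (by omega), ← image_toRat_eq_hexagonVertices,
      toRat_injective.mem_set_image] at hx
    simp only [Set.mem_insert_iff, Set.mem_singleton_iff] at hx
    rcases hx with rfl | rfl | rfl | rfl | rfl | rfl
    · exact isPrimitive_of_apply_eq_one (form 0 1) (by simp)
    · exact isPrimitive_of_apply_eq_one (form 0 (-1)) (by simp)
    · exact isPrimitive_of_apply_eq_one (form 1 (-k)) (by simp [hkz]; ring)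
    · exact isPrimitive_of_apply_eq_one (form (-1) k) (by simp [hkz]; ring)
    · exact isPrimitive_of_apply_eq_one (form 0 1) (by simp)
    · exact isPrimitive_of_apply_eq_one (form 0 (-1)) (by simp)
  localIndex := fun _ => localIndex_hexagon hl

/-- If `2 k < l`, the lattice point `(1, 0)` lies in the interior of the hexagon scaled by
`1 / k`, so `k` is not in the order set. -/
lemma le_two_mul_of_mem_orderSet_hexagon {k : ℕ} (hk : k ∈ orderSet (hexagon l)) : l ≤ 2 * k := by
  by_contra! hlt
  have hl : 0 < l := by omega
  obtain ⟨hk0, hk⟩ := hk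
  have hkq : (0 : ℚ) < k := by exact_mod_cast hk0
  have hlq : (0 : ℚ) < l := by exact_mod_cast hl
  have hltq : 2 * (k : ℚ) < l := by exact_mod_cast hlt
  have hdiv : (l : ℚ)⁻¹ * k < 1 / 2 := by
    rw [inv_mul_lt_iff₀ hlq]
    linarith
  have hdiv0 : 0 < (l : ℚ)⁻¹ * k := by positivity
  have hmem : toRat ![1, 0] ∈ interiorQ ((k : ℚ)⁻¹ • hexagon l) ∩ latticePoints (Fin 2 → ℤ) := by
    refine ⟨?_, ![1, 0], rfl⟩
    rw [interiorQ_smul (inv_ne_zero hkq.ne'), Set.mem_inv_smul_set_iff₀ hkq.ne']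
    have e : coordB l ((k : ℚ) • toRat ![1, 0]) = (l : ℚ)⁻¹ * k := by simp [coordB, mul_comm]
    have e' : coordA l ((k : ℚ) • toRat ![1, 0]) = -((l : ℚ)⁻¹ * k) := by simp [coordA, mul_comm]
    -- The coordinates are `∓k/l`, so the binding inequality is the third: their difference is `2k/l
    -- < 1` in absolute value.
    refine mem_interiorQ_hexagon hl ?_ ?_ ?_ <;> simp only [e, e'] <;> rw [abs_lt] <;>
      constructor <;> linarith
  rw [hk, Set.mem_singleton_iff, ← toRat_zero] at hmem
  have := congrFun (toRat_injective hmem) 0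
  simp at this

end Hexagon

end LReflexive

theorem mainTheorem12 :
    (∀ (N : Type*) [AddCommGroup N] [Module.Free ℤ N] [Module.Finite ℤ N]
        (_ : Module.finrank ℤ N = 2) (l : ℕ) (P : Set (LReflexive.RatSpace N)),
        LReflexive.IsReflexive l P →
          (LReflexive.orderSet P).Nonempty ∧ (LReflexive.order P : ℚ) ≤ ((l : ℚ) + 1) / 2) ∧
    (∀ l : ℕ, Odd l →
        LReflexive.IsReflexive l (LReflexive.hexagon l) ∧
        (LReflexive.vertices (LReflexive.hexagon l)).ncard = 6 ∧
        (LReflexive.orderSet (LReflexive.hexagon l)).Nonempty ∧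
        (LReflexive.order (LReflexive.hexagon l) : ℚ) = ((l : ℚ) + 1) / 2) := by
  refine ⟨fun N _ _ _ hN l P hP => ?_, fun l hl => ?_⟩
  · have hmem := hP.half_mem_orderSet hN
    refine ⟨⟨_, hmem⟩, ?_⟩
    have h1 : LReflexive.order P ≤ (l + 1) / 2 := Nat.sInf_le hmem
    have h2 : 2 * LReflexive.order P ≤ l + 1 := by omega
    have h3 : 2 * (LReflexive.order P : ℚ) ≤ l + 1 := by exact_mod_cast h2
    linarith
  · have hP := LReflexive.isReflexive_hexagon hl
    have hmem := hP.half_mem_orderSet (by simp)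
    refine ⟨hP, ?_, ⟨_, hmem⟩, ?_⟩
    · rw [LReflexive.vertices_hexagon hl.pos, LReflexive.ncard_hexagonVertices hl.pos]
    · have h1 : LReflexive.order (LReflexive.hexagon l) ≤ (l + 1) / 2 := Nat.sInf_le hmem
      -- The order set is nonempty, so its infimum is a member and not the default `0`; parity then
      -- improves `l` to `l + 1`.
      have h2 : l ≤ 2 * LReflexive.order (LReflexive.hexagon l) :=
        LReflexive.le_two_mul_of_mem_orderSet_hexagon (Nat.sInf_mem ⟨_, hmem⟩)
      have h3 : 2 * LReflexive.order (LReflexive.hexagon l) = l + 1 := by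
        obtain ⟨k, hk⟩ := hl
        omega
      have h4 : 2 * (LReflexive.order (LReflexive.hexagon l) : ℚ) = l + 1 := by exact_mod_cast h3
      linarith
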